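/- **Setting.** Let $G$ be a group with a finite generating set $S$, word metric $d_G$ and balls $B(g,\alpha)=\{h\in G : d_G(g,h)<\alpha\}$ (so $B(g,\infty)=G$), and let $\mathcal F$ be a family of subgroups of $G$, i.e. a set of subgroups closed under conjugation and under taking subgroups. Let $\overline X$ be a compact metrisable space on which $G$ acts by homeomorphisms, let $X\subseteq\overline X$ be a dense $G$-invariant subset (so $\overline X$ is a metrisable compactification of $X$), and put $\partial X=\overline X\setminus X$. For a $G$-space $Y$, a subset $U\subseteq G\times Y$ (with the diagonal action) is an $\mathcal F$-subset if its translates $gU$ are pairwise equal or disjoint and its stabiliser $\{g : gU=U\}$ belongs to $\mathcal F$. For $\alpha\in[0,\infty]$, an $\alpha$-eqasdim covering of $G\times Y$ is a $G$-invariant covering $\mathcal U$ of $G\times Y$ by open $\mathcal F$-subsets such that for every $(g,y)\in G\times Y$ there is $U\in\mathcal U$ with $B(g,\alpha)\times\{y\}\subseteq U$. For a family $\mathcal U$ of subsets of a set $Z$, $\dim\mathcal U=\sup_{z\in Z}|\{U\in\mathcal U : z\in U\}|-1\in\{-1,0,1,\dots,\infty\}$. **Theorem.** Assume that one of the following holds: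 (a) $X$ is a finite-dimensional simplicial complex (with the weak or with the metric topology), $G$ acts simplicially and the (setwise) stabilisers of simplices belong to $\mathcal F$; or $X$ is a finite-dimensional $G$-CW-complex whose cell stabilisers belong to $\mathcal F$; (b) $X$ is regular, the $G$-action on $X$ is proper (every point has a neighbourhood $U$ with $\{g : gU\cap U\ne\emptyset\}$ finite), the isotropy groups belong to $\mathcal F$, and either (i) the action on $X$ is cocompact ($G\backslash X$ is compact), or (ii) $X$ has finite covering dimension and admits a $G$-invariant metric inducing its topology. Then: 1. There exists an $\infty$-eqasdim covering $\mathcal U_\infty$ of $G\times X$ with $\dim\mathcal U_\infty<\infty$. 2. For every $\infty$-eqasdim covering $\mathcal U_\infty$ of $G\times X$, every $\alpha\in[0,\infty]$ and every $\alpha$-eqasdim covering $\mathcal V$ of $G\times\partial X$, there exists an $\alpha$-eqasdim covering $\mathcal U$ of $G\times\overline X$ with $$\dim\mathcal U\le\dim\mathcal V+\dim\mathcal U_\infty+1 .$$ Moreover, $\mathcal U$ extends $\mathcal V$: there is a $G$-invariant subfamily $\mathcal W\subseteq\mathcal U$ with $\dim\mathcal W=\dim\mathcal V$ such that $U\mapsto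 U\cap(G\times\partial X)$ is a bijection from $\mathcal W$ onto $\mathcal V$. -/

import Mathlib

open scoped Pointwise ENNReal

namespace EqAsdim

/-- A family of subgroups of `G`: closed under conjugation and under taking subgroups. -/
def IsFamily {G : Type*} [Group G] (F : Set (Subgroup G)) : Prop :=
  (∀ H ∈ F, ∀ g : G, H.map (MulAut.conj g).toMonoidHom ∈ F) ∧
    ∀ H ∈ F, ∀ K : Subgroup G, K ≤ H → K ∈ F

/-- Word length with respect to `S ∪ S⁻¹` (meaningful when `S` generates `G`). -/
noncomputable def wordLength {G : Type*} [Group G] (S : Set G) (g : G) : ℕ :=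
  sInf {n : ℕ | ∃ l : List G, l.length = n ∧ (∀ s ∈ l, s ∈ S ∨ s⁻¹ ∈ S) ∧ l.prod = g}

/-- The (left invariant) word metric `d_G`. -/
noncomputable def wordDist {G : Type*} [Group G] (S : Set G) (g h : G) : ℕ :=
  wordLength S (g⁻¹ * h)

/-- The ball `B(g, α) = {h | d_G(g, h) < α}`; for `α = ∞` it is the whole group. -/
def wordBall {G : Type*} [Group G] (S : Set G) (g : G) (α : ℝ≥0∞) : Set G :=
  {h | (wordDist S g h : ℝ≥0∞) < α}

/-- `dim 𝒰 = sup_y #{U ∈ 𝒰 | y ∈ U} - 1`, with values in `{-1, 0, 1, …, ∞}`. -/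
noncomputable def familyDim {Y : Type*} (𝒰 : Set (Set Y)) : EReal :=
  (((⨆ y : Y, {U ∈ 𝒰 | y ∈ U}.encard : ℕ∞) : ℝ≥0∞) : EReal) - 1

/-- `F`-subsets of a `G`-set: translates are equal or disjoint, and the stabiliser is in `F`. -/
def IsFSubset {G Y : Type*} [Group G] [MulAction G Y] (F : Set (Subgroup G)) (U : Set Y) : Prop :=
  (∀ g h : G, g • U = h • U ∨ Disjoint (g • U) (h • U)) ∧ MulAction.stabilizer G U ∈ F

/-- An equivariant family of sets. -/
def IsInvariantFamily (G : Type*) {Y : Type*} [Group G] [MulAction G Y] (𝒰 : Set (Set Y)) : Prop :=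
  ∀ g : G, ∀ U ∈ 𝒰, g • U ∈ 𝒰

/-- `F`-covers: equivariant covers by `F`-subsets. -/
structure IsFCover {G Y : Type*} [Group G] [MulAction G Y] (F : Set (Subgroup G))
    (𝒰 : Set (Set Y)) : Prop where
  covers : ⋃₀ 𝒰 = Set.univ
  isFSubset : ∀ U ∈ 𝒰, IsFSubset F U
  invariant : IsInvariantFamily G 𝒰

/-- `α` is a `G`-Lebesgue number of `𝒰`. -/
def IsLebesgueNumber {G Y : Type*} [Group G] (S : Set G) (α : ℝ≥0∞)
    (𝒰 : Set (Set (G × Y))) : Prop :=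
  ∀ (g : G) (y : Y), ∃ U ∈ 𝒰, wordBall S g α ×ˢ {y} ⊆ U

/-- Open `F`-covers of `G × Y` (with the diagonal action) having `α` as a `G`-Lebesgue number.
Bounds on the dimension are always stated separately, through `familyDim`. -/
structure IsEqasdimCover {G Y : Type*} [Group G] [TopologicalSpace G] [TopologicalSpace Y]
    [MulAction G Y] (S : Set G) (F : Set (Subgroup G)) (α : ℝ≥0∞)
    (𝒰 : Set (Set (G × Y))) : Prop where
  isOpen : ∀ U ∈ 𝒰, IsOpen U
  isFCover : IsFCover F 𝒰
  lebesgue : IsLebesgueNumber S α 𝒰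

/-! ### Simplicial complexes -/

/-- The points of the geometric realisation of `K`, in barycentric coordinates. -/
def Realization {V : Type*} (K : AbstractSimplicialComplex V) : Type _ :=
  {x : V → ℝ // (∀ v, 0 ≤ x v) ∧ ∃ s ∈ K.faces, (∀ v ∉ s, x v = 0) ∧ ∑ v ∈ s, x v = 1}

/-- The metric topology on the realisation: the coarsest one for which the barycentric coordinates
are continuous, which on `|K|` is the topology of the distance `∑ v, |x v - y v|`. -/
abbrev Realization.metricTopology {V : Type*} (K : AbstractSimplicialComplex V) :
    TopologicalSpace (Realization K) :=
  TopologicalSpace.induced (fun x : Realization K => x.1) Pi.topologicalSpace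

/-- The weak topology on the realisation: the final topology for the inclusions of the closed
simplices with their Euclidean topology. -/
abbrev Realization.weakTopology {V : Type*} (K : AbstractSimplicialComplex V) :
    TopologicalSpace (Realization K) :=
  ⨆ s ∈ K.faces, TopologicalSpace.coinduced
    (fun x : {x : Realization K // ∀ v ∉ s, x.1 v = 0} => x.1)
    (TopologicalSpace.induced (fun x => x.1.1) Pi.topologicalSpace)

/-- `X` is a finite-dimensional simplicial complex (with the weak or the metric topology), `G` acts
simplicially, and the (setwise) stabilisers of the simplices belong to `F`. -/
def SimplicialCondition.{u} {G : Type*} [Group G] (F : Set (Subgroup G)) (X : Type u)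
    [t : TopologicalSpace X] [MulAction G X] : Prop :=
  ∃ (V : Type u) (K : AbstractSimplicialComplex V) (_ : MulAction G V) (e : X ≃ Realization K),
    (∃ n : ℕ, ∀ s ∈ K.faces, s.card ≤ n + 1) ∧
    (∀ (g : G), ∀ s ∈ K.faces, s.map (MulAction.toPerm g).toEmbedding ∈ K.faces) ∧
    (t = (Realization.weakTopology K).induced e ∨ t = (Realization.metricTopology K).induced e) ∧
    (∀ (g : G) (x : X) (v : V), (e (g • x)).1 v = (e x).1 (g⁻¹ • v)) ∧
    ∀ s ∈ K.faces, MulAction.stabilizer G (s : Set V) ∈ F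

/-! ### `G`-CW-complexes -/

/-- `X` is a finite-dimensional `G`-CW-complex with cell stabilisers in `F`: a CW-complex whose open
cells are permuted by `G`, such that an element mapping an open cell to itself fixes it pointwise. -/
def CWCondition {G : Type*} [Group G] (F : Set (Subgroup G)) (X : Type*)
    [TopologicalSpace X] [MulAction G X] : Prop :=
  ∃ _ : Topology.CWComplex (Set.univ : Set X),
    (∃ n : ℕ, ∀ m > n, IsEmpty (Topology.RelCWComplex.cell (Set.univ : Set X) m)) ∧
    (∀ (g : G) (m : ℕ) (i : Topology.RelCWComplex.cell (Set.univ : Set X) m),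
      ∃ j : Topology.RelCWComplex.cell (Set.univ : Set X) m,
        g • Topology.RelCWComplex.openCell m i = Topology.RelCWComplex.openCell m j) ∧
    (∀ (g : G) (m : ℕ) (i : Topology.RelCWComplex.cell (Set.univ : Set X) m),
      g • Topology.RelCWComplex.openCell m i = Topology.RelCWComplex.openCell m i →
        ∀ x ∈ Topology.RelCWComplex.openCell m i, g • x = x) ∧
    ∀ (m : ℕ) (i : Topology.RelCWComplex.cell (Set.univ : Set X) m),
      MulAction.stabilizer G (Topology.RelCWComplex.openCell m i) ∈ F

/-! ### Proper actions -/

/-- Proper action of a discrete group: every point has a neighbourhood meeting only finitely many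
of its translates. -/
def IsProperAction (G : Type*) [Group G] (X : Type*) [TopologicalSpace X] [MulAction G X] : Prop :=
  ∀ x : X, ∃ U ∈ nhds x, {g : G | ((g • U) ∩ U).Nonempty}.Finite

/-- The covering dimension of `X` is at most `n`. -/
def CoveringDimLE (X : Type*) [TopologicalSpace X] (n : ℕ) : Prop :=
  ∀ 𝒞 : Set (Set X), (∀ U ∈ 𝒞, IsOpen U) → ⋃₀ 𝒞 = Set.univ →
    ∃ 𝒟 : Set (Set X), (∀ W ∈ 𝒟, IsOpen W) ∧ ⋃₀ 𝒟 = Set.univ ∧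
      (∀ W ∈ 𝒟, ∃ U ∈ 𝒞, W ⊆ U) ∧ familyDim 𝒟 ≤ ((n : ℝ) : EReal)

/-- There is a `G`-invariant metric inducing the topology of `X`. -/
def AdmitsInvariantMetric (G : Type*) [Group G] (X : Type*) [t : TopologicalSpace X]
    [MulAction G X] : Prop :=
  ∃ m : MetricSpace X, m.toUniformSpace.toTopologicalSpace = t ∧
    ∀ (g : G) (x y : X), dist (g • x) (g • y) = dist x y

/-- `X` is regular, the action is proper with isotropy groups in `F`, and either the action is
cocompact, or `X` is of finite covering dimension and admits a `G`-invariant metric. -/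
def ProperCondition {G : Type*} [Group G] (F : Set (Subgroup G)) (X : Type*)
    [TopologicalSpace X] [MulAction G X] : Prop :=
  RegularSpace X ∧ IsProperAction G X ∧ (∀ x : X, MulAction.stabilizer G x ∈ F) ∧
    (CompactSpace (MulAction.orbitRel.Quotient G X) ∨
      (∃ n : ℕ, CoveringDimLE X n) ∧ AdmitsInvariantMetric G X)

/-! ### The boundary -/

/-- `∂X`, the complement of the invariant subset `X`, as an invariant subset. -/
def boundary {G Z : Type*} [Group G] [MulAction G Z] (X : SubMulAction G Z) :
    SubMulAction G Z where
  carrier := (X : Set Z)ᶜ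
  smul_mem' g _ hz h := hz (by simpa using X.smul_mem g⁻¹ h)

/-- The restriction `U ∩ (G × A)` of `U ⊆ G × Z`, as a subset of `G × A`. -/
def trace {G Z : Type*} [Group G] [MulAction G Z] (A : SubMulAction G Z) (U : Set (G × Z)) :
    Set (G × A) :=
  {p | (p.1, (p.2 : Z)) ∈ U}

end EqAsdim

/-!
The proof rests on an equivariant extension of open sets. The action on the metrisable space `Z`
need not preserve any metric `d` of `Z`, but the metric `d((g, x), (g, y)) = d(g⁻¹x, g⁻¹y)` on
`G × Z`, with different layers infinitely far apart, is invariant. Kuratowski's operator `extend`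
with respect to it turns the open subsets of `G × A`, for any invariant subset `A ⊆ Z`, into open
subsets of `G × Z` with the given traces. It is equivariant and respects finite intersections and
the empty set, so it maps `F`-subsets to `F`-subsets (`IsFSubset.extend`) and preserves the
dimension of a family (`order_image_extend`). No closedness of `A` is needed.

An `α`-eqasdim covering of `G × X̄` extending a covering `𝒱` of `G × ∂X` is therefore obtained by
extending `𝒱` from `∂X` and the given covering of `G × X` from `X`
(`IsEqasdimCover.extend_union`).

The same operator reduces the existence of a finite-dimensional `∞`-eqasdim covering of `G × X` to a
decomposition of `X` into finitely many strata, invariant subsets that are disjoint unions of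
relatively open cells, permuted by `G`, with stabilisers in `F`: extend the sets `G × c`, for all
cells `c` (`exists_isEqasdimCover_top_of_strata`). For simplicial and CW-complexes the strata are
the unions of the open simplices or cells of a given dimension. For a proper cocompact action,
finitely many orbits of slices are used.

For a proper isometric action on a space of covering dimension at most `n`, the strata come from a
locally finite closed covering of the orbit space `G \ X` of order at most `n + 1`, each member of
which lies in the image of a slice: points are sorted by the number of members containing them
(`exists_strata_of_isClosed_cover`). Such a covering exists because `G \ X` is the union of
countably many closed subsets that are homeomorphic to closed subsets of `X`, namely the images of
the sets of points fixed by the isotropy group of `x` in a small ball around `x`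
(`isClosed_iUnion_smul_of_subset_fixedBall`, `fixedBall_mem_nhdsWithin`). Coverings can be shrunk to
order at most `n + 1` over each of these sets (`CoveringDimLE.exists_shrinking`), hence over all of
`G \ X` by the argument of the countable sum theorem (`exists_isClosed_shrinking`).
-/

namespace EqAsdim

open Set Metric

/-! ### The order of a family of sets -/

/-- The order of a family of sets: the largest number of members with a common point, so that
`familyDim` is the order minus one. -/
noncomputable def order {Y : Type*} (𝒰 : Set (Set Y)) : ℕ∞ :=
  ⨆ y : Y, {U ∈ 𝒰 | y ∈ U}.encard

lemma encard_le_order {Y : Type*} (𝒰 : Set (Set Y)) (y : Y) :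
    {U ∈ 𝒰 | y ∈ U}.encard ≤ order 𝒰 :=
  le_iSup (fun y : Y => {U ∈ 𝒰 | y ∈ U}.encard) y

lemma familyDim_eq {Y : Type*} (𝒰 : Set (Set Y)) :
    familyDim 𝒰 = (((order 𝒰 : ℕ∞) : ℝ≥0∞) : EReal) - 1 := rfl

lemma familyDim_congr {Y Z : Type*} {𝒰 : Set (Set Y)} {𝒱 : Set (Set Z)}
    (h : order 𝒰 = order 𝒱) : familyDim 𝒰 = familyDim 𝒱 := by
  rw [familyDim_eq, familyDim_eq, h]

lemma order_union_le {Y : Type*} (𝒰 𝒱 : Set (Set Y)) : order (𝒰 ∪ 𝒱) ≤ order 𝒰 + order 𝒱 := by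
  refine iSup_le fun y => ?_
  have : {U ∈ 𝒰 ∪ 𝒱 | y ∈ U} = {U ∈ 𝒰 | y ∈ U} ∪ {U ∈ 𝒱 | y ∈ U} := by
    ext U; simp only [mem_union, mem_ofPred_eq]; tauto
  rw [this]
  exact (encard_union_le _ _).trans (add_le_add (encard_le_order _ _) (encard_le_order _ _))

lemma coe_natCast_sub_one (k : ℕ) : (((k : ℕ∞) : ℝ≥0∞) : EReal) - 1 = ((k - 1 : ℝ) : EReal) := by
  rw [ENat.toENNReal_coe, ← ENNReal.ofReal_natCast, EReal.coe_ennreal_ofReal,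
    max_eq_left (Nat.cast_nonneg k), EReal.coe_sub, EReal.coe_one]

lemma coe_top_sub_one : (((⊤ : ℕ∞) : ℝ≥0∞) : EReal) - 1 = ⊤ := by
  rw [ENat.toENNReal_top, EReal.coe_ennreal_top, ← EReal.coe_one, EReal.top_sub_coe]

lemma familyDim_le_add {Y Z W : Type*} {𝒰 : Set (Set Y)} {𝒱 : Set (Set Z)} {𝒲 : Set (Set W)}
    (h : order 𝒰 ≤ order 𝒱 + order 𝒲) :
    familyDim 𝒰 ≤ familyDim 𝒱 + familyDim 𝒲 + 1 := by
  rw [familyDim_eq, familyDim_eq, familyDim_eq]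
  generalize order 𝒰 = a at *
  generalize order 𝒱 = b at *
  generalize order 𝒲 = c at *
  induction b with
  | top =>
    rw [coe_top_sub_one]
    induction c with
    | top =>
      rw [coe_top_sub_one, EReal.top_add_top, ← EReal.coe_one, EReal.top_add_coe]
      exact le_top
    | coe c =>
      rw [coe_natCast_sub_one, EReal.top_add_coe, ← EReal.coe_one, EReal.top_add_coe]
      exact le_top
  | coe b =>
    rw [coe_natCast_sub_one]
    induction c with
    | top =>
      rw [coe_top_sub_one, EReal.coe_add_top, ← EReal.coe_one, EReal.top_add_coe]
      exact le_top
    | coe c =>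
      lift a to ℕ using ne_top_of_le_ne_top (by simp [← Nat.cast_add]) h
      have h' : (a : ℝ) ≤ b + c := by exact_mod_cast h
      rw [coe_natCast_sub_one, coe_natCast_sub_one, ← EReal.coe_one, ← EReal.coe_add,
        ← EReal.coe_add, EReal.coe_le_coe_iff]
      linarith

lemma familyDim_lt_top {Y : Type*} {𝒰 : Set (Set Y)} {n : ℕ} (h : order 𝒰 ≤ n) :
    familyDim 𝒰 < ⊤ := by
  rw [familyDim_eq]
  lift order 𝒰 to ℕ using ne_top_of_le_ne_top (by simp) h with k
  rw [coe_natCast_sub_one]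
  exact EReal.coe_lt_top _

lemma order_le_of_familyDim_le {Y : Type*} {𝒰 : Set (Set Y)} {n : ℕ}
    (h : familyDim 𝒰 ≤ ((n : ℝ) : EReal)) : order 𝒰 ≤ n + 1 := by
  rw [familyDim_eq] at h
  generalize order 𝒰 = a at *
  induction a with
  | top =>
    rw [coe_top_sub_one] at h
    exact absurd h (EReal.coe_lt_top _).not_ge
  | coe k =>
    rw [coe_natCast_sub_one, EReal.coe_le_coe_iff] at h
    have : (k : ℝ) ≤ n + 1 := by linarith
    exact_mod_cast this

/-! ### Extending open sets from an invariant subset -/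

section Extend

variable {G Z : Type*} [Group G] [MulAction G Z]

/-- The extension of `U ⊆ G × A` to a subset of `G × Z`. It is Kuratowski's extension of the
relatively open sets of a subspace of a metric space, taken with respect to the metric
`d((g, x), (g, y)) = d(g⁻¹x, g⁻¹y)` on `G × Z` (different layers being infinitely far apart), which
is invariant under the diagonal action although `d` itself need not be invariant. -/
def extend [PseudoEMetricSpace Z] (A : SubMulAction G Z) (U : Set (G × A)) : Set (G × Z) :=
  {p | infEDist (p.1⁻¹ • p.2) (A : Set Z) <
    infEDist (p.1⁻¹ • p.2) {z | ∃ h : z ∈ A, (p.1, p.1 • (⟨z, h⟩ : A)) ∉ U}}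

lemma smul_trace (A : SubMulAction G Z) (g : G) (U : Set (G × Z)) :
    trace A (g • U) = g • trace A U := by
  ext p
  rw [mem_smul_set_iff_inv_smul_mem]
  change (p.1, (p.2 : Z)) ∈ g • U ↔ _
  rw [mem_smul_set_iff_inv_smul_mem]
  rfl

variable [PseudoEMetricSpace Z] (A : SubMulAction G Z)

lemma extend_inter (U V : Set (G × A)) : extend A (U ∩ V) = extend A U ∩ extend A V := by
  ext p
  have : {z | ∃ h : z ∈ A, (p.1, p.1 • (⟨z, h⟩ : A)) ∉ U ∩ V} =
      {z | ∃ h : z ∈ A, (p.1, p.1 • (⟨z, h⟩ : A)) ∉ U} ∪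
        {z | ∃ h : z ∈ A, (p.1, p.1 • (⟨z, h⟩ : A)) ∉ V} := by
    ext z
    simp only [mem_inter_iff, mem_ofPred_eq, mem_union, ← exists_or]
    exact exists_congr fun h => by tauto
  rw [extend, mem_ofPred_eq, this, infEDist_union, lt_inf_iff]
  rfl

lemma extend_empty : extend A (∅ : Set (G × A)) = ∅ := by
  ext p
  have : {z | ∃ h : z ∈ A, (p.1, p.1 • (⟨z, h⟩ : A)) ∉ (∅ : Set (G × A))} = (A : Set Z) := by
    ext z; simp
  rw [extend, mem_ofPred_eq, this]
  simp

lemma smul_extend (g : G) (U : Set (G × A)) : g • extend A U = extend A (g • U) := by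
  ext p
  rw [mem_smul_set_iff_inv_smul_mem]
  have h1 : (g⁻¹ • p).1⁻¹ • (g⁻¹ • p).2 = p.1⁻¹ • p.2 := by
    simp [smul_smul]
  have h2 : {z | ∃ h : z ∈ A, ((g⁻¹ • p).1, (g⁻¹ • p).1 • (⟨z, h⟩ : A)) ∉ U} =
      {z | ∃ h : z ∈ A, (p.1, p.1 • (⟨z, h⟩ : A)) ∉ g • U} := by
    ext z
    refine exists_congr fun h => not_congr ?_
    rw [mem_smul_set_iff_inv_smul_mem]
    simp [smul_smul]
  simp only [extend, mem_ofPred_eq, h1, h2]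

lemma isOpen_extend [TopologicalSpace G] [DiscreteTopology G] [ContinuousConstSMul G Z]
    (U : Set (G × A)) : IsOpen (extend A U) := by
  have hg (g : G) : Continuous fun z : Z => g⁻¹ • z := continuous_const_smul g⁻¹
  refine isOpen_lt ?_ ?_ <;> refine continuous_prod_of_discrete_left.2 fun g => ?_
  · exact continuous_infEDist.comp (hg g)
  · exact (continuous_infEDist (s := {z | ∃ h : z ∈ A, (g, g • (⟨z, h⟩ : A)) ∉ U})).comp (hg g)

lemma trace_extend [TopologicalSpace G] [ContinuousConstSMul G Z] {U : Set (G × A)}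
    (hU : IsOpen U) : trace A (extend A U) = U := by
  ext ⟨g, a⟩
  have hA : g⁻¹ • (a : Z) ∈ A := A.smul_mem _ a.2
  have h0 : infEDist (g⁻¹ • (a : Z)) (A : Set Z) = 0 := infEDist_zero_of_mem hA
  change infEDist (g⁻¹ • (a : Z)) (A : Set Z) < infEDist (g⁻¹ • (a : Z))
    {z | ∃ h : z ∈ A, (g, g • (⟨z, h⟩ : A)) ∉ U} ↔ _
  rw [h0, pos_iff_ne_zero, ne_eq, ← mem_closure_iff_infEDist_zero]
  constructor
  · intro h
    by_contra hU'
    refine h (subset_closure ⟨hA, ?_⟩)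
    have : g • (⟨g⁻¹ • (a : Z), hA⟩ : A) = a := Subtype.ext (by simp)
    rwa [this]
  · intro ha hcl
    have hcont : Continuous fun z : A => (g, g • z) :=
      continuous_const.prodMk
        (((continuous_const_smul g).comp continuous_subtype_val).subtype_mk _)
    obtain ⟨O, hO, hOU⟩ := isOpen_induced_iff.1 (hU.preimage hcont)
    have haO : (⟨g⁻¹ • (a : Z), hA⟩ : A) ∈ Subtype.val ⁻¹' O := by
      rw [hOU]
      have : g • (⟨g⁻¹ • (a : Z), hA⟩ : A) = a := Subtype.ext (by simp)
      rwa [mem_preimage, this]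
    obtain ⟨z, hzO, hz, hzU⟩ := mem_closure_iff.1 hcl O hO haO
    refine hzU ?_
    have : (⟨z, hz⟩ : A) ∈ Subtype.val ⁻¹' O := hzO
    rwa [hOU] at this

lemma bijOn_trace_extend [TopologicalSpace G] [ContinuousConstSMul G Z] {𝒱 : Set (Set (G × A))}
    (h𝒱 : ∀ V ∈ 𝒱, IsOpen V) : BijOn (trace A) (extend A '' 𝒱) 𝒱 := by
  refine ⟨?_, ?_, fun V hV => ⟨_, ⟨V, hV, rfl⟩, trace_extend A (h𝒱 V hV)⟩⟩
  · rintro _ ⟨V, hV, rfl⟩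
    rwa [trace_extend A (h𝒱 V hV)]
  · rintro _ ⟨V, hV, rfl⟩ _ ⟨W, hW, rfl⟩ h
    rw [trace_extend A (h𝒱 V hV), trace_extend A (h𝒱 W hW)] at h
    rw [h]

/-- Since the extension respects finite intersections and the empty set, members of a family whose
extensions have a common point have a common point themselves. -/
lemma order_image_extend [TopologicalSpace G] [ContinuousConstSMul G Z] {𝒱 : Set (Set (G × A))}
    (h𝒱 : ∀ V ∈ 𝒱, IsOpen V) : order (extend A '' 𝒱) = order 𝒱 := by
  have hinj : InjOn (extend A) 𝒱 := fun V hV W hW h => by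
    rw [← trace_extend A (h𝒱 V hV), ← trace_extend A (h𝒱 W hW), h]
  refine le_antisymm (iSup_le fun p => ?_) (iSup_le fun q => ?_)
  · set T := {V ∈ 𝒱 | p ∈ extend A V} with hT
    have himg : {U ∈ extend A '' 𝒱 | p ∈ U} ⊆ extend A '' T := by
      rintro _ ⟨⟨V, hV, rfl⟩, hp⟩
      exact ⟨V, ⟨hV, hp⟩, rfl⟩
    refine (encard_le_encard himg).trans ((encard_image_le _ _).trans ?_)
    refine ENat.forall_natCast_le_iff_le.1 fun n hn => ?_
    obtain ⟨t, htT, ht⟩ := exists_subset_encard_eq hn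
    rcases T.eq_empty_or_nonempty with h0 | ⟨V₀, hV₀⟩
    · rw [h0, encard_empty] at hn
      exact hn.trans bot_le
    have hfin : t.Finite := finite_of_encard_eq_coe ht
    have hp : p ∈ extend A (V₀ ∩ ⋂₀ t) := by
      clear ht
      induction t, hfin using Set.Finite.induction_on with
      | empty => simpa using hV₀.2
      | @insert W s _ _ ih =>
        rw [sInter_insert, inter_left_comm, extend_inter]
        exact ⟨(htT (mem_insert _ _)).2, ih ((subset_insert _ _).trans htT)⟩
    obtain ⟨q, hq⟩ : (V₀ ∩ ⋂₀ t).Nonempty := by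
      by_contra h
      rw [not_nonempty_iff_eq_empty] at h
      rw [h, extend_empty] at hp
      exact hp
    rw [← ht]
    refine (encard_le_encard fun V hV => ?_).trans (encard_le_order 𝒱 q)
    exact ⟨(htT hV).1, hq.2 V hV⟩
  · have hsub : {V ∈ 𝒱 | q ∈ V} ⊆ 𝒱 := fun V hV => hV.1
    rw [← (hinj.mono hsub).encard_image]
    refine (encard_le_encard ?_).trans (encard_le_order _ (q.1, (q.2 : Z)))
    rintro _ ⟨V, ⟨hV, hq⟩, rfl⟩
    refine ⟨⟨V, hV, rfl⟩, ?_⟩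
    change q ∈ trace A (extend A V)
    rwa [trace_extend A (h𝒱 V hV)]

lemma IsFSubset.extend [TopologicalSpace G] [ContinuousConstSMul G Z] {F : Set (Subgroup G)}
    {U : Set (G × A)} (hU : IsFSubset F U) (hUo : IsOpen U) : IsFSubset F (extend A U) := by
  refine ⟨fun g h => ?_, ?_⟩
  · rw [smul_extend, smul_extend]
    refine (hU.1 g h).imp (fun h => by rw [h]) fun h => ?_
    rw [disjoint_iff_inter_eq_empty] at h ⊢
    rw [← extend_inter, h, extend_empty]
  · convert hU.2 using 1
    ext g
    rw [MulAction.mem_stabilizer_iff, MulAction.mem_stabilizer_iff]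
    refine ⟨fun h => ?_, fun h => by rw [smul_extend, h]⟩
    have := congrArg (trace A) h
    rwa [smul_trace, trace_extend A hUo] at this

lemma IsInvariantFamily.image_extend {𝒱 : Set (Set (G × A))} (h : IsInvariantFamily G 𝒱) :
    IsInvariantFamily G (EqAsdim.extend A '' 𝒱) := by
  rintro g _ ⟨V, hV, rfl⟩
  exact ⟨g • V, h g V hV, (smul_extend A g V).symm⟩

end Extend

/-- Extending coverings of `G × A` and `G × B` gives a covering of `G × Z` if `Z = A ∪ B`. -/
theorem IsEqasdimCover.extend_union {G Z : Type*} [Group G] [TopologicalSpace G]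
    [DiscreteTopology G] [PseudoEMetricSpace Z] [MulAction G Z] [ContinuousConstSMul G Z]
    {S : Set G} {F : Set (Subgroup G)} {α : ℝ≥0∞} (A B : SubMulAction G Z)
    (hAB : ∀ z, z ∈ A ∨ z ∈ B) {𝒱 : Set (Set (G × A))} {𝒲 : Set (Set (G × B))}
    (h𝒱 : IsEqasdimCover S F α 𝒱) (h𝒲 : IsEqasdimCover S F α 𝒲) :
    IsEqasdimCover S F α (extend A '' 𝒱 ∪ extend B '' 𝒲) := by
  have mem_of_mem (C : SubMulAction G Z) {V : Set (G × C)} (hV : IsOpen V) {q : G × C}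
      (hq : q ∈ V) : (q.1, (q.2 : Z)) ∈ extend C V := by
    change q ∈ trace C (extend C V)
    rwa [trace_extend C hV]
  have cov (C : SubMulAction G Z) {𝒱 : Set (Set (G × C))} (h : IsEqasdimCover S F α 𝒱) (g : G)
      (c : C) : ∃ U ∈ extend C '' 𝒱, (g, (c : Z)) ∈ U := by
    obtain ⟨V, hV, hgV⟩ : (g, c) ∈ ⋃₀ 𝒱 := by rw [h.isFCover.covers]; trivial
    exact ⟨_, ⟨V, hV, rfl⟩, mem_of_mem C (h.isOpen V hV) hgV⟩
  have leb (C : SubMulAction G Z) {𝒱 : Set (Set (G × C))} (h : IsEqasdimCover S F α 𝒱) (g : G)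
      (c : C) : ∃ U ∈ extend C '' 𝒱, wordBall S g α ×ˢ {(c : Z)} ⊆ U := by
    obtain ⟨V, hV, hgV⟩ := h.lebesgue g c
    refine ⟨_, ⟨V, hV, rfl⟩, ?_⟩
    rintro ⟨k, z⟩ ⟨hk, hz⟩
    obtain rfl : z = c := hz
    exact mem_of_mem C (h.isOpen V hV) (q := (k, c)) (hgV ⟨hk, rfl⟩)
  refine ⟨?_, ⟨?_, ?_, ?_⟩, ?_⟩
  · rintro _ (⟨V, -, rfl⟩ | ⟨V, -, rfl⟩)
    exacts [isOpen_extend A V, isOpen_extend B V]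
  · refine eq_univ_of_forall fun ⟨g, z⟩ => ?_
    rcases hAB z with hz | hz
    · obtain ⟨U, hU, h⟩ := cov A h𝒱 g ⟨z, hz⟩
      exact ⟨U, Or.inl hU, h⟩
    · obtain ⟨U, hU, h⟩ := cov B h𝒲 g ⟨z, hz⟩
      exact ⟨U, Or.inr hU, h⟩
  · rintro _ (⟨V, hV, rfl⟩ | ⟨V, hV, rfl⟩)
    exacts [(h𝒱.isFCover.isFSubset V hV).extend A (h𝒱.isOpen V hV),
      (h𝒲.isFCover.isFSubset V hV).extend B (h𝒲.isOpen V hV)]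
  · rintro g U (hU | hU)
    exacts [Or.inl (h𝒱.isFCover.invariant.image_extend A g U hU),
      Or.inr (h𝒲.isFCover.invariant.image_extend B g U hU)]
  · intro g z
    rcases hAB z with hz | hz
    · obtain ⟨U, hU, h⟩ := leb A h𝒱 g ⟨z, hz⟩
      exact ⟨U, Or.inl hU, h⟩
    · obtain ⟨U, hU, h⟩ := leb B h𝒲 g ⟨z, hz⟩
      exact ⟨U, Or.inr hU, h⟩

lemma IsEqasdimCover.of_top {G Y : Type*} [Group G] [TopologicalSpace G] [TopologicalSpace Y]
    [MulAction G Y] {S : Set G} {F : Set (Subgroup G)} {𝒰 : Set (Set (G × Y))}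
    (h : IsEqasdimCover S F ⊤ 𝒰) (α : ℝ≥0∞) : IsEqasdimCover S F α 𝒰 := by
  refine ⟨h.isOpen, h.isFCover, fun g y => ?_⟩
  obtain ⟨U, hU, hgU⟩ := h.lebesgue g y
  have hball : wordBall S g α ⊆ wordBall S g ⊤ := fun k hk =>
    lt_of_lt_of_le (show (_ : ℝ≥0∞) < α from hk) le_top
  exact ⟨U, hU, (prod_mono hball subset_rfl).trans hgU⟩

/-! ### Stratified spaces -/

/-- A family `𝒞` of subsets of a `G`-space, thought of as the cells of its union: the cells are
pairwise disjoint, permuted by `G`, relatively open in their union, and have stabilisers in `F`. -/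
structure IsFStratum {G X : Type*} [Group G] [TopologicalSpace X] [MulAction G X]
    (F : Set (Subgroup G)) (𝒞 : Set (Set X)) : Prop where
  pairwiseDisjoint : 𝒞.PairwiseDisjoint id
  invariant : IsInvariantFamily G 𝒞
  stabilizer_mem : ∀ c ∈ 𝒞, MulAction.stabilizer G c ∈ F
  exists_isOpen : ∀ c ∈ 𝒞, ∃ O : Set X, IsOpen O ∧ O ∩ ⋃₀ 𝒞 = c

/-- The union of the cells of an invariant family, as an invariant subset. -/
def support {G X : Type*} [Group G] [MulAction G X] (𝒞 : Set (Set X))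
    (h : IsInvariantFamily G 𝒞) : SubMulAction G X where
  carrier := ⋃₀ 𝒞
  smul_mem' := by
    rintro g x ⟨c, hc, hx⟩
    exact ⟨g • c, h g c hc, smul_mem_smul_set hx⟩

/-- A metrisable `G`-space that is the union of finitely many strata has a finite-dimensional
`∞`-eqasdim covering: it consists of the extensions of the sets `G × c`, for all cells `c`. -/
theorem exists_isEqasdimCover_top_of_strata {G X : Type*} [Group G] [TopologicalSpace G]
    [DiscreteTopology G] [TopologicalSpace X] [TopologicalSpace.MetrizableSpace X] [MulAction G X]
    [ContinuousConstSMul G X] (S : Set G) {F : Set (Subgroup G)} {N : ℕ}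
    (𝒞 : Fin N → Set (Set X)) (h𝒞 : ∀ i, IsFStratum F (𝒞 i)) (hcov : ∀ x, ∃ i, ∃ c ∈ 𝒞 i, x ∈ c) :
    ∃ 𝒰 : Set (Set (G × X)), IsEqasdimCover S F ⊤ 𝒰 ∧ familyDim 𝒰 < ⊤ := by
  let _ : MetricSpace X := TopologicalSpace.metrizableSpaceMetric X
  let A (i : Fin N) : SubMulAction G X := support (𝒞 i) (h𝒞 i).invariant
  let P (i : Fin N) (c : Set X) : Set (G × A i) := {p | (p.2 : X) ∈ c}
  have smul_P (i : Fin N) (g : G) (c : Set X) : g • P i c = P i (g • c) := by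
    ext p
    rw [mem_smul_set_iff_inv_smul_mem]
    change g⁻¹ • (p.2 : X) ∈ c ↔ (p.2 : X) ∈ g • c
    rw [mem_smul_set_iff_inv_smul_mem]
  have P_disj (i : Fin N) {c d : Set X} (h : Disjoint c d) : P i c ∩ P i d = ∅ := by
    ext p
    simpa [P] using fun h1 h2 => disjoint_left.1 h h1 h2
  have P_open (i : Fin N) (c : Set X) (hc : c ∈ 𝒞 i) : IsOpen (P i c) := by
    obtain ⟨O, hO, hOc⟩ := (h𝒞 i).exists_isOpen c hc
    have : P i c = (fun p : G × A i => (p.2 : X)) ⁻¹' O := by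
      ext p
      have hp : (p.2 : X) ∈ ⋃₀ 𝒞 i := p.2.2
      change (p.2 : X) ∈ c ↔ (p.2 : X) ∈ O
      rw [← hOc]
      exact and_iff_left hp
    rw [this]
    exact hO.preimage (continuous_subtype_val.comp continuous_snd)
  have P_F (i : Fin N) (c : Set X) (hc : c ∈ 𝒞 i) : IsFSubset F (P i c) := by
    refine ⟨fun g h => ?_, ?_⟩
    · rw [smul_P, smul_P]
      by_cases hgh : g • c = h • c
      · exact Or.inl (by rw [hgh])
      · exact Or.inr (disjoint_iff_inter_eq_empty.2 (P_disj i ((h𝒞 i).pairwiseDisjoint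
          ((h𝒞 i).invariant g c hc) ((h𝒞 i).invariant h c hc) hgh)))
    · convert (h𝒞 i).stabilizer_mem c hc using 1
      ext g
      rw [MulAction.mem_stabilizer_iff, MulAction.mem_stabilizer_iff, smul_P]
      refine ⟨fun h => ?_, fun h => by rw [h]⟩
      have key (d : Set X) (hd : d ∈ 𝒞 i) : (fun p : G × A i => (p.2 : X)) '' P i d = d := by
        ext x
        refine ⟨?_, fun hx => ⟨(1, ⟨x, d, hd, hx⟩), hx, rfl⟩⟩
        rintro ⟨p, hp, rfl⟩
        exact hp
      rw [← key _ ((h𝒞 i).invariant g c hc), h, key c hc]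
  have mem_ext (i : Fin N) (c : Set X) (hc : c ∈ 𝒞 i) (g : G) (x : X) (hx : x ∈ c) :
      (g, x) ∈ extend (A i) (P i c) := by
    change ((g, ⟨x, c, hc, hx⟩) : G × A i) ∈ trace (A i) (extend (A i) (P i c))
    rw [trace_extend (A i) (P_open i c hc)]
    exact hx
  let 𝒰 : Set (Set (G × X)) := ⋃ i, (fun c => extend (A i) (P i c)) '' 𝒞 i
  refine ⟨𝒰, ⟨?_, ⟨?_, ?_, ?_⟩, ?_⟩, familyDim_lt_top (n := N) (iSup_le fun p => ?_)⟩
  · intro U hU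
    obtain ⟨i, c, hc, rfl⟩ := mem_iUnion.1 hU
    exact isOpen_extend _ _
  · refine eq_univ_of_forall fun ⟨g, x⟩ => ?_
    obtain ⟨i, c, hc, hx⟩ := hcov x
    exact ⟨_, mem_iUnion.2 ⟨i, c, hc, rfl⟩, mem_ext i c hc g x hx⟩
  · intro U hU
    obtain ⟨i, c, hc, rfl⟩ := mem_iUnion.1 hU
    exact (P_F i c hc).extend _ (P_open i c hc)
  · intro g U hU
    obtain ⟨i, c, hc, rfl⟩ := mem_iUnion.1 hU
    refine mem_iUnion.2 ⟨i, g • c, (h𝒞 i).invariant g c hc, ?_⟩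
    change extend (A i) (P i (g • c)) = g • extend (A i) (P i c)
    rw [smul_extend, smul_P]
  · intro g x
    obtain ⟨i, c, hc, hx⟩ := hcov x
    refine ⟨_, mem_iUnion.2 ⟨i, c, hc, rfl⟩, ?_⟩
    rintro ⟨k, y⟩ ⟨-, hy⟩
    obtain rfl : y = x := hy
    exact mem_ext i c hc k y hx
  · -- Two cells of the same stratum with overlapping extensions agree, so a point lies in at most
    -- one member of the covering for every stratum.
    have hex : ∀ U : {U ∈ 𝒰 | p ∈ U}, ∃ i, ∃ c ∈ 𝒞 i, extend (A i) (P i c) = U := fun U => by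
      obtain ⟨i, c, hc, h⟩ := mem_iUnion.1 U.2.1
      exact ⟨i, c, hc, h⟩
    choose i c hc h using hex
    have hinj : Function.Injective i := by
      intro U V hUV
      have hcd : c U = c V := by
        by_contra hne
        have hd := P_disj (i U) ((h𝒞 (i U)).pairwiseDisjoint (hc U) (hUV ▸ hc V) hne)
        have hpU : p ∈ extend (A (i U)) (P (i U) (c U)) := by rw [h U]; exact U.2.2
        have hpV : p ∈ extend (A (i U)) (P (i U) (c V)) := by rw [hUV, h V]; exact V.2.2
        have := mem_inter hpU hpV
        rw [← extend_inter] at this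
        rwa [show P (i U) (c U) ∩ P (i U) (c V) = ∅ from hd, extend_empty] at this
      exact Subtype.ext (by rw [← h U, ← h V, hcd, hUV])
    have := ENat.card_le_card_of_injective hinj
    rwa [ENat.card_eq_coe_fintype_card (α := Fin N), Fintype.card_fin] at this

/-! ### Simplicial complexes -/

lemma Realization.exists_support {V : Type*} (K : AbstractSimplicialComplex V)
    (x : Realization K) : ∃ s ∈ K.faces, ∀ v, 0 < x.1 v ↔ v ∈ s := by
  classical
  obtain ⟨hpos, s, hs, h0, h1⟩ := x.2
  refine ⟨s.filter fun v => 0 < x.1 v, ?_, fun v => ?_⟩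
  · refine (K.isRelLowerSet_faces hs).2 (Finset.filter_subset _ _) ?_
    by_contra hne
    rw [Finset.not_nonempty_iff_eq_empty, Finset.filter_eq_empty_iff] at hne
    have : ∑ v ∈ s, x.1 v = 0 :=
      Finset.sum_eq_zero fun v hv => le_antisymm (not_lt.1 (hne hv)) (hpos v)
    rw [this] at h1
    exact zero_ne_one h1
  · rw [Finset.mem_filter]
    refine ⟨fun h => ⟨?_, h⟩, fun h => h.2⟩
    by_contra hv
    rw [h0 v hv] at h
    exact lt_irrefl _ h

lemma Realization.exists_barycenter {V : Type*} (K : AbstractSimplicialComplex V) {s : Finset V}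
    (hs : s ∈ K.faces) : ∃ x : Realization K, ∀ v, 0 < x.1 v ↔ v ∈ s := by
  classical
  have hne : s.Nonempty := (K.isRelLowerSet_faces hs).1
  have hc : (0 : ℝ) < s.card := by exact_mod_cast hne.card_pos
  refine ⟨⟨fun v => if v ∈ s then (s.card : ℝ)⁻¹ else 0, fun v => ?_, s, hs, fun v hv => if_neg hv,
    ?_⟩, fun v => ?_⟩
  · dsimp only
    split_ifs
    exacts [(inv_pos.2 hc).le, le_rfl]
  · rw [Finset.sum_congr rfl fun v hv => if_pos hv, Finset.sum_const, nsmul_eq_mul,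
      mul_inv_cancel₀ hc.ne']
  · dsimp only
    split_ifs with h
    exacts [iff_of_true (inv_pos.2 hc) h, iff_of_false (lt_irrefl _) h]

lemma Realization.weakTopology_le_metricTopology {V : Type*} (K : AbstractSimplicialComplex V) :
    weakTopology K ≤ metricTopology K := by
  refine iSup₂_le fun s _ => ?_
  rw [← continuous_iff_coinduced_le, continuous_induced_rng]
  exact continuous_induced_dom

/-- The strata are formed by the open simplices of a given dimension. -/
lemma SimplicialCondition.exists_strata {G : Type*} [Group G] {F : Set (Subgroup G)}
    (hF : IsFamily F) {X : Type*} [t : TopologicalSpace X] [MulAction G X]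
    (h : SimplicialCondition F X) : ∃ (N : ℕ) (𝒞 : Fin N → Set (Set X)),
      (∀ i, IsFStratum F (𝒞 i)) ∧ ∀ x, ∃ i, ∃ c ∈ 𝒞 i, x ∈ c := by
  obtain ⟨V, K, _, e, ⟨n, hn⟩, hK, ht, he, hst⟩ := h
  have hcont (v : V) : Continuous fun x => (e x).1 v := by
    have hle : t ≤ (Realization.metricTopology K).induced e := by
      rcases ht with rfl | rfl
      exacts [induced_mono (Realization.weakTopology_le_metricTopology K), le_rfl]
    refine continuous_le_dom hle ?_
    let _ : TopologicalSpace (Realization K) := Realization.metricTopology K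
    let _ : TopologicalSpace X := (Realization.metricTopology K).induced e
    have h1 : Continuous e := continuous_induced_dom
    have h2 : Continuous fun x : Realization K => x.1 := continuous_induced_dom
    exact (continuous_apply v).comp (h2.comp h1)
  let cell (s : Finset V) : Set X := {x | ∀ v, 0 < (e x).1 v ↔ v ∈ s}
  have cell_inj {s s' : Finset V} {x : X} (h : x ∈ cell s) (h' : x ∈ cell s') : s = s' := by
    ext v
    rw [← h v, ← h' v]
  have smul_cell (g : G) (s : Finset V) :
      g • cell s = cell (s.map (MulAction.toPerm g).toEmbedding) := by
    ext x
    rw [mem_smul_set_iff_inv_smul_mem]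
    change (∀ v, 0 < (e (g⁻¹ • x)).1 v ↔ v ∈ s) ↔ ∀ v, 0 < (e x).1 v ↔ v ∈ s.map _
    simp only [he, inv_inv]
    refine ⟨fun h v => ?_, fun h v => ?_⟩
    · have := h (g⁻¹ • v)
      rw [smul_inv_smul] at this
      rw [this, Finset.mem_map]
      refine ⟨fun hv => ⟨_, hv, smul_inv_smul g v⟩, ?_⟩
      rintro ⟨w, hw, rfl⟩
      change g⁻¹ • g • w ∈ s
      rwa [inv_smul_smul]
    · rw [h, Finset.mem_map]
      refine ⟨?_, fun hv => ⟨v, hv, rfl⟩⟩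
      rintro ⟨w, hw, hwv⟩
      obtain rfl : w = v := MulAction.injective g hwv
      exact hw
  refine ⟨n + 2, fun i => {c | ∃ s ∈ K.faces, s.card = i ∧ c = cell s}, fun i => ⟨?_, ?_, ?_, ?_⟩,
    fun x => ?_⟩
  · rintro _ ⟨s, -, -, rfl⟩ _ ⟨s', -, -, rfl⟩ hne
    refine disjoint_left.2 fun x hx hx' => hne ?_
    rw [cell_inj hx hx']
  · rintro g _ ⟨s, hs, hi, rfl⟩
    exact ⟨_, hK g s hs, by rw [Finset.card_map, hi], smul_cell g s⟩
  · rintro _ ⟨s, hs, -, rfl⟩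
    refine hF.2 _ (hst s hs) _ fun g hg => ?_
    rw [MulAction.mem_stabilizer_iff, smul_cell] at hg
    obtain ⟨x, hx⟩ := Realization.exists_barycenter K hs
    have hx' : e.symm x ∈ cell s := fun v => by rw [e.apply_symm_apply]; exact hx v
    have := cell_inj (hg ▸ hx') hx'
    rw [MulAction.mem_stabilizer_iff]
    conv_rhs => rw [← this]
    rw [Finset.coe_map]
    rfl
  · rintro _ ⟨s, hs, hi, rfl⟩
    refine ⟨⋂ v ∈ s, {x | 0 < (e x).1 v},
      isOpen_biInter_finset fun v _ => isOpen_lt continuous_const (hcont v), ?_⟩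
    ext x
    constructor
    · rintro ⟨hx, _, ⟨s', -, hi', rfl⟩, hx'⟩
      have hss : s ⊆ s' := fun v hv => (hx' v).1 (mem_iInter₂.1 hx v hv)
      rwa [Finset.eq_of_subset_of_card_le hss (by rw [hi, hi'])]
    · exact fun hx => ⟨mem_iInter₂.2 fun v hv => (hx v).2 hv, _, ⟨s, hs, hi, rfl⟩, hx⟩
  · obtain ⟨s, hs, hx⟩ := Realization.exists_support K (e x)
    exact ⟨⟨s.card, Nat.lt_succ_of_le (hn s hs)⟩, cell s, ⟨s, hs, rfl, rfl⟩, hx⟩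

/-! ### CW-complexes -/

/-- The union of all open cells of dimension at most `m`, except for a given `m`-cell, is closed. -/
lemma isClosed_skeleton_diff_openCell {X : Type*} [TopologicalSpace X] [T2Space X]
    [Topology.CWComplex (univ : Set X)] (m : ℕ)
    (i : Topology.RelCWComplex.cell (univ : Set X) m) :
    IsClosed {x : X | ∃ k ≤ m, ∃ j : Topology.RelCWComplex.cell (univ : Set X) k,
      x ∈ Topology.RelCWComplex.openCell k j ∧ x ∉ Topology.RelCWComplex.openCell m i} := by
  refine Topology.CWComplex.isClosed_of_disjoint_openCell_or_isClosed_inter_closedCell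
    (C := (univ : Set X)) (subset_univ _) fun k _ j => ?_
  by_cases h : k ≤ m ∧ (⟨k, j⟩ : Σ n, Topology.RelCWComplex.cell (univ : Set X) n) ≠ ⟨m, i⟩
  · right
    rw [inter_eq_right.2]
    · exact Topology.RelCWComplex.isClosed_closedCell
    · rw [← Topology.RelCWComplex.cellFrontier_union_openCell_eq_closedCell]
      rintro x (hx | hx)
      · obtain ⟨I, hI⟩ := Topology.CWComplex.cellFrontier_subset_finite_openCell k j
        obtain ⟨l, hl, a, -, ha⟩ := by simpa only [mem_iUnion, exists_prop] using hI hx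
        refine ⟨l, by omega, a, ha, ?_⟩
        refine disjoint_left.1 (Topology.RelCWComplex.disjoint_openCell_of_ne fun heq => ?_) ha
        have := congrArg Sigma.fst heq
        simp only at this
        omega
      · exact ⟨k, h.1, j, hx, disjoint_left.1
          (Topology.RelCWComplex.disjoint_openCell_of_ne h.2) hx⟩
  · left
    refine disjoint_left.2 ?_
    rintro x ⟨l, hl, a, ha, hxi⟩ hxj
    by_cases hk : k ≤ m
    · have : (⟨k, j⟩ : Σ n, Topology.RelCWComplex.cell (univ : Set X) n) = ⟨m, i⟩ := by
        by_contra hne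
        exact h ⟨hk, hne⟩
      obtain ⟨rfl, hji⟩ := Sigma.mk.inj_iff.1 this
      rw [eq_of_heq hji] at hxj
      exact hxi hxj
    · refine disjoint_left.1 (Topology.RelCWComplex.disjoint_openCell_of_ne fun heq => ?_) ha hxj
      have := congrArg Sigma.fst heq
      simp only at this
      omega

/-- The strata are formed by the open cells of a given dimension. -/
lemma CWCondition.exists_strata {G : Type*} [Group G] {F : Set (Subgroup G)}
    {X : Type*} [TopologicalSpace X] [T2Space X] [MulAction G X]
    (h : CWCondition F X) : ∃ (N : ℕ) (𝒞 : Fin N → Set (Set X)),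
      (∀ i, IsFStratum F (𝒞 i)) ∧ ∀ x, ∃ i, ∃ c ∈ 𝒞 i, x ∈ c := by
  obtain ⟨_, ⟨n, hn⟩, hperm, -, hst⟩ := h
  refine ⟨n + 1, fun k => range (Topology.RelCWComplex.openCell (C := (univ : Set X)) (k : ℕ)),
    fun k => ⟨?_, ?_, ?_, ?_⟩, fun x => ?_⟩
  · rintro _ ⟨i, rfl⟩ _ ⟨j, rfl⟩ hne
    refine Topology.RelCWComplex.disjoint_openCell_of_ne fun heq => hne ?_
    rw [eq_of_heq (Sigma.mk.inj_iff.1 heq).2]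
  · rintro g _ ⟨i, rfl⟩
    obtain ⟨j, hj⟩ := hperm g k i
    exact ⟨j, hj.symm⟩
  · rintro _ ⟨i, rfl⟩
    exact hst k i
  · rintro _ ⟨i, rfl⟩
    refine ⟨_, (isClosed_skeleton_diff_openCell (k : ℕ) i).isOpen_compl, ?_⟩
    ext x
    constructor
    · rintro ⟨hx, _, ⟨j, rfl⟩, hxj⟩
      by_contra hxi
      exact hx ⟨k, le_rfl, j, hxj, hxi⟩
    · exact fun hx => ⟨fun ⟨_, _, _, _, h⟩ => h hx, _, ⟨i, rfl⟩, hx⟩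
  · have hx : x ∈ (univ : Set X) := trivial
    rw [← Topology.CWComplex.iUnion_openCell_eq_complex (C := (univ : Set X))] at hx
    obtain ⟨m, i, hi⟩ := mem_iUnion₂.1 hx
    have hm : m < n + 1 := by
      by_contra hm
      exact (hn m (by omega)).false i
    exact ⟨⟨m, hm⟩, _, ⟨i, rfl⟩, hi⟩

/-! ### Slices of proper actions -/

/-- An open neighbourhood `U` of `x` that is invariant under the isotropy group of `x` and disjoint
from its translates by all other elements. -/
structure IsSlice (G : Type*) {X : Type*} [Group G] [TopologicalSpace X] [MulAction G X] (x : X)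
    (U : Set X) : Prop where
  isOpen : IsOpen U
  mem : x ∈ U
  smul_eq : ∀ g : G, g • x = x → g • U = U
  smul_self_eq : ∀ g : G, ((g • U) ∩ U).Nonempty → g • x = x

section Slice

variable {G X : Type*} [Group G] [TopologicalSpace X] [MulAction G X] {x : X} {U : Set X}

lemma IsSlice.eq_or_disjoint (hU : IsSlice G x U) (g h : G) :
    g • U = h • U ∨ Disjoint (g • U) (h • U) := by
  by_cases hd : Disjoint (g • U) (h • U)
  · exact Or.inr hd
  · left
    obtain ⟨y, hyg, hyh⟩ := not_disjoint_iff.1 hd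
    have h1 : (h⁻¹ * g) • x = x := by
      refine hU.smul_self_eq _ ⟨h⁻¹ • y, ?_, mem_smul_set_iff_inv_smul_mem.1 hyh⟩
      rw [mul_smul]
      exact smul_mem_smul_set hyg
    have := hU.smul_eq _ h1
    rwa [mul_smul, inv_smul_eq_iff] at this

/-- If a nonempty subset of `gU`, for a slice `U` at `x`, is mapped to itself by `h`, then `h` lies
in the isotropy group of `gx`. -/
lemma IsSlice.smul_smul_eq (hU : IsSlice G x U) {g h : G} {c : Set X} (hc : c.Nonempty)
    (hcU : c ⊆ g • U) (hh : h • c = c) : h • g • x = g • x := by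
  obtain ⟨y, hy⟩ := hc
  have hy' : y ∈ h • g • U := by
    rw [← hh] at hy
    exact smul_set_mono hcU hy
  have : (g⁻¹ * h * g) • x = x := by
    refine hU.smul_self_eq _ ⟨g⁻¹ • y, ?_, mem_smul_set_iff_inv_smul_mem.1 (hcU hy)⟩
    rw [mul_smul, mul_smul]
    exact smul_mem_smul_set hy'
  rw [mul_smul, mul_smul, inv_smul_eq_iff] at this
  exact this

lemma IsProperAction.finite_stabilizer (h : IsProperAction G X) (x : X) :
    {g : G | g • x = x}.Finite := by
  obtain ⟨U, hU, hfin⟩ := h x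
  refine hfin.subset fun g hg => ⟨x, ?_, mem_of_mem_nhds hU⟩
  rw [mem_smul_set_iff_inv_smul_mem, inv_smul_eq_iff.2 (Eq.symm hg)]
  exact mem_of_mem_nhds hU

/-- Separate `x` from its finitely many other translates that stay in a small neighbourhood, then
intersect the translates of the resulting neighbourhood under the finite isotropy group. -/
lemma IsProperAction.exists_isSlice [T2Space X] [ContinuousConstSMul G X]
    (h : IsProperAction G X) (x : X) : ∃ U, IsSlice G x U := by
  obtain ⟨W, hW, hfin⟩ := h x
  have hsep (g : G) : ∃ V, IsOpen V ∧ x ∈ V ∧ (g • x ≠ x → (g • V) ∩ V = ∅) := by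
    by_cases hg : g • x = x
    · exact ⟨univ, isOpen_univ, mem_univ x, fun h => absurd hg h⟩
    · obtain ⟨A, B, hA, hB, hxA, hxB, hAB⟩ := t2_separation hg
      refine ⟨((g • ·) ⁻¹' A) ∩ B, (hA.preimage (continuous_const_smul g)).inter hB, ⟨hxA, hxB⟩,
        fun _ => eq_empty_of_forall_notMem ?_⟩
      rintro _ ⟨⟨y, hy, rfl⟩, hy'⟩
      exact disjoint_left.1 hAB hy.1 hy'.2
  choose V hVo hxV hV using hsep
  set T := {g : G | ((g • W) ∩ W).Nonempty} with hT
  let V' : Set X := interior W ∩ ⋂ g ∈ T, V g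
  have hV'o : IsOpen V' := isOpen_interior.inter (hfin.isOpen_biInter fun g _ => hVo g)
  have hxV' : x ∈ V' := ⟨mem_interior_iff_mem_nhds.2 hW, mem_iInter₂.2 fun g _ => hxV g⟩
  have hV' (g : G) (hg : ((g • V') ∩ V').Nonempty) : g • x = x := by
    by_contra hne
    have hgT : g ∈ T := hg.mono (inter_subset_inter
      (smul_set_mono (inter_subset_left.trans interior_subset))
      (inter_subset_left.trans interior_subset))
    have hsub : V' ⊆ V g := inter_subset_right.trans (biInter_subset_of_mem hgT)
    exact (hg.mono (inter_subset_inter (smul_set_mono hsub) hsub)).ne_empty (hV g hne)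
  refine ⟨⋂ g ∈ {g : G | g • x = x}, g • V', ?_, ?_, fun g hg => ?_, fun g hg => hV' g ?_⟩
  · exact (h.finite_stabilizer x).isOpen_biInter fun g _ => hV'o.smul g
  · refine mem_iInter₂.2 fun g hg => mem_smul_set_iff_inv_smul_mem.2 ?_
    rwa [inv_smul_eq_iff.2 (Eq.symm hg)]
  · ext y
    rw [mem_smul_set_iff_inv_smul_mem]
    simp only [mem_iInter, mem_smul_set_iff_inv_smul_mem, mem_ofPred_eq, smul_smul]
    refine ⟨fun hy k hk => ?_, fun hy k hk => ?_⟩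
    · have := hy (g⁻¹ * k) (by rw [mul_smul, hk, inv_smul_eq_iff, hg])
      simpa using this
    · have := hy (g * k) (by rw [mul_smul, hk, hg])
      simpa using this
  · have hsub : ⋂ g ∈ {g : G | g • x = x}, g • V' ⊆ V' := by
      refine (biInter_subset_of_mem (show (1 : G) ∈ {g : G | g • x = x} from one_smul G x)).trans ?_
      rw [one_smul]
    exact hg.mono (inter_subset_inter (smul_set_mono hsub) hsub)

end Slice

/-- In the cocompact case finitely many orbits of slices cover the space, and each of them is a
stratum. -/
lemma IsProperAction.exists_strata_of_compactSpace {G : Type*} [Group G] {F : Set (Subgroup G)}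
    (hF : IsFamily F) {X : Type*} [TopologicalSpace X] [T2Space X] [MulAction G X]
    [ContinuousConstSMul G X] (h : IsProperAction G X)
    (hst : ∀ x : X, MulAction.stabilizer G x ∈ F)
    [CompactSpace (MulAction.orbitRel.Quotient G X)] : ∃ (N : ℕ) (𝒞 : Fin N → Set (Set X)),
      (∀ i, IsFStratum F (𝒞 i)) ∧ ∀ x, ∃ i, ∃ c ∈ 𝒞 i, x ∈ c := by
  choose U hU using h.exists_isSlice
  let π : X → MulAction.orbitRel.Quotient G X := Quotient.mk _
  have hπ (x : X) : IsOpen (π '' U x) :=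
    isOpenMap_quotient_mk'_mul _ (hU x).isOpen
  obtain ⟨t, ht⟩ := isCompact_univ.elim_finite_subcover (fun x => π '' U x) hπ fun q _ => by
    obtain ⟨x, rfl⟩ := Quotient.exists_rep q
    exact mem_iUnion.2 ⟨x, x, (hU x).mem, rfl⟩
  let e := t.equivFin.symm
  refine ⟨t.card, fun i => range fun g : G => g • U (e i), fun i => ⟨?_, ?_, ?_, ?_⟩, fun x => ?_⟩
  · rintro _ ⟨g, rfl⟩ _ ⟨k, rfl⟩ hne
    exact ((hU (e i)).eq_or_disjoint g k).resolve_left hne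
  · rintro k _ ⟨g, rfl⟩
    exact ⟨k * g, mul_smul _ _ _⟩
  · rintro _ ⟨g, rfl⟩
    refine hF.2 _ (hst (g • (e i : X))) _ fun k hk => ?_
    exact (hU (e i)).smul_smul_eq ⟨_, smul_mem_smul_set (hU (e i)).mem⟩ subset_rfl hk
  · rintro _ ⟨g, rfl⟩
    exact ⟨_, (hU (e i)).isOpen.smul g, inter_eq_left.2 (subset_sUnion_of_mem ⟨g, rfl⟩)⟩
  · obtain ⟨y, hy, z, hz, hzx⟩ := mem_iUnion₂.1 (ht (mem_univ (π x)))
    obtain ⟨g, hg⟩ : ∃ g : G, g • x = z := Quotient.exact hzx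
    refine ⟨t.equivFin ⟨y, hy⟩, _, ⟨g⁻¹, rfl⟩, ?_⟩
    simp only [e, Equiv.symm_apply_apply]
    rw [mem_smul_set_iff_inv_smul_mem, inv_inv, hg]
    exact hz

/-! ### Shrinking coverings to bounded order -/

/-- A form of the countable sum theorem of dimension theory. If a space is the union of countably
many sets, over each of which open coverings can be shrunk to order at most `n + 1`, then every
point-finite open covering has a closed shrinking of order at most `n + 1`: shrink successively over
the given sets, in such a way that each covering contains the closures of the next one, and
intersect. -/
theorem exists_isClosed_shrinking {Y ι : Type*} [TopologicalSpace Y] [NormalSpace Y] {n : ℕ}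
    (A : ℕ → Set Y) (hA : ∀ y, ∃ j, y ∈ A j)
    (hshrink : ∀ (j : ℕ) (U : ι → Set Y), (∀ i, IsOpen (U i)) → ⋃ i, U i = univ →
      ∃ W : ι → Set Y, (∀ i, IsOpen (W i)) ∧ ⋃ i, W i = univ ∧ (∀ i, W i ⊆ U i) ∧
        ∀ y ∈ A j, {i | y ∈ W i}.encard ≤ n + 1)
    (U : ι → Set Y) (hU : ∀ i, IsOpen (U i)) (hUc : ⋃ i, U i = univ)
    (hUf : ∀ y, {i | y ∈ U i}.Finite) :
    ∃ K : ι → Set Y, (∀ i, IsClosed (K i)) ∧ ⋃ i, K i = univ ∧ (∀ i, K i ⊆ U i) ∧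
      ∀ y, {i | y ∈ K i}.encard ≤ n + 1 := by
  let T := {U : ι → Set Y // (∀ i, IsOpen (U i)) ∧ ⋃ i, U i = univ ∧ ∀ y, {i | y ∈ U i}.Finite}
  have step (j : ℕ) (U : T) : ∃ V : T, (∀ i, closure (V.1 i) ⊆ U.1 i) ∧
      ∀ y ∈ A j, {i | y ∈ closure (V.1 i)}.encard ≤ n + 1 := by
    obtain ⟨U, hU, hUc, hUf⟩ := U
    obtain ⟨W, hW, hWc, hWU, hWn⟩ := hshrink j U hU hUc
    obtain ⟨V, hVc, hV, hVW⟩ := exists_iUnion_eq_closure_subset hW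
      (fun y => (hUf y).subset fun i hi => hWU i hi) hWc
    refine ⟨⟨V, hV, hVc, fun y => (hUf y).subset fun i hi => hWU i (hVW i (subset_closure hi))⟩,
      fun i => (hVW i).trans (hWU i), fun y hy => ?_⟩
    exact (encard_le_encard fun i hi => hVW i hi).trans (hWn y hy)
  choose next hnext hnext' using step
  let s : ℕ → T := fun k => Nat.rec ⟨U, hU, hUc, hUf⟩ (fun j V => next j V) k
  have hs (j : ℕ) : s (j + 1) = next j (s j) := rfl
  have hanti (i : ι) : Antitone fun j => (s j).1 i :=
    antitone_nat_of_succ_le fun j => subset_closure.trans (hnext j (s j) i)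
  refine ⟨fun i => ⋂ j, closure ((s (j + 1)).1 i),
    fun i => isClosed_iInter fun j => isClosed_closure, ?_,
    fun i y hy => hnext 0 (s 0) i (mem_iInter.1 hy 0), fun y => ?_⟩
  · refine eq_univ_of_forall fun y => ?_
    by_contra hy
    rw [mem_iUnion, not_exists] at hy
    have hy' (i : ι) : ∃ j, y ∉ (s j).1 i := by
      by_contra h
      push Not at h
      exact hy i (mem_iInter.2 fun j => subset_closure (h (j + 1)))
    choose f hf using hy'
    -- Only finitely many indices matter at `y`, so a late enough covering would miss `y`.
    obtain ⟨m, hm⟩ := ((hUf y).image f).bddAbove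
    have hcov : y ∈ ⋃ i, (s m).1 i := by rw [(s m).2.2.1]; trivial
    obtain ⟨i, hi⟩ := mem_iUnion.1 hcov
    have hiU : y ∈ U i := hanti i (Nat.zero_le m) hi
    exact hf i (hanti i (hm ⟨i, hiU, rfl⟩) hi)
  · obtain ⟨j, hj⟩ := hA y
    refine (encard_le_encard fun i hi => ?_).trans (hnext' j (s j) y hj)
    exact mem_iInter.1 hi j

/-- A closed subset `E` of a space of covering dimension at most `n` that is embedded in `Y` by a
map `π` as a closed subset allows to shrink coverings of `Y` to order at most `n + 1` over it. -/
lemma CoveringDimLE.exists_shrinking {X Y ι : Type*} [TopologicalSpace X] [TopologicalSpace Y]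
    {n : ℕ} (h : CoveringDimLE X n) {π : X → Y} (hπ : Continuous π) {E : Set X} (hE : IsClosed E)
    (hinj : InjOn π E) (hclosed : ∀ K ⊆ E, IsClosed K → IsClosed (π '' K))
    (U : ι → Set Y) (hU : ∀ i, IsOpen (U i)) (hUc : ⋃ i, U i = univ) :
    ∃ W : ι → Set Y, (∀ i, IsOpen (W i)) ∧ ⋃ i, W i = univ ∧ (∀ i, W i ⊆ U i) ∧
      ∀ y ∈ π '' E, {i | y ∈ W i}.encard ≤ n + 1 := by
  have hex (y : Y) : ∃ i, y ∈ U i := by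
    rw [← mem_iUnion, hUc]; trivial
  obtain ⟨𝒟, h𝒟, h𝒟c, h𝒟U, h𝒟n⟩ := h (range fun i => π ⁻¹' U i ∪ Eᶜ)
    (by rintro _ ⟨i, rfl⟩; exact ((hU i).preimage hπ).union hE.isOpen_compl)
    (eq_univ_of_forall fun x => by
      obtain ⟨i, hi⟩ := hex (π x)
      exact ⟨_, ⟨i, rfl⟩, Or.inl hi⟩)
  have hch (D : 𝒟) : ∃ i, (D : Set X) ⊆ π ⁻¹' U i ∪ Eᶜ := by
    obtain ⟨_, ⟨i, rfl⟩, hi⟩ := h𝒟U D D.2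
    exact ⟨i, hi⟩
  choose a ha using hch
  let V (i : ι) : Set X := ⋃ D ∈ {D : 𝒟 | a D = i}, (D : Set X)
  have hV (i : ι) : IsOpen (V i) := isOpen_biUnion fun D _ => h𝒟 D D.2
  have hVU (i : ι) {x : X} (hx : x ∈ E) (hxV : x ∈ V i) : π x ∈ U i := by
    obtain ⟨D, rfl, hxD⟩ := mem_iUnion₂.1 hxV
    exact (ha D hxD).resolve_right fun h => h hx
  refine ⟨fun i => U i \ π '' (E \ V i),
    fun i => (hU i).sdiff (hclosed _ sdiff_subset (hE.sdiff (hV i))), ?_, fun i => sdiff_subset, ?_⟩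
  · refine eq_univ_of_forall fun y => ?_
    by_cases hy : y ∈ π '' E
    · obtain ⟨x, hx, rfl⟩ := hy
      obtain ⟨D, hD, hxD⟩ : x ∈ ⋃₀ 𝒟 := by rw [h𝒟c]; trivial
      have hxV : x ∈ V (a ⟨D, hD⟩) := mem_iUnion₂.2 ⟨⟨D, hD⟩, rfl, hxD⟩
      refine mem_iUnion.2 ⟨a ⟨D, hD⟩, hVU _ hx hxV, ?_⟩
      rintro ⟨x', hx', hxx'⟩
      rw [hinj hx'.1 hx hxx'] at hx'
      exact hx'.2 hxV
    · obtain ⟨i, hi⟩ := hex y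
      exact mem_iUnion.2 ⟨i, hi, fun h => hy (image_mono sdiff_subset h)⟩
  · rintro _ ⟨x, hx, rfl⟩
    have hsub : {i | π x ∈ U i \ π '' (E \ V i)} ⊆ a '' {D : 𝒟 | x ∈ (D : Set X)} := by
      rintro i ⟨-, hi⟩
      have hxV : x ∈ V i := by
        by_contra hxV
        exact hi ⟨x, ⟨hx, hxV⟩, rfl⟩
      obtain ⟨D, hD, hxD⟩ := mem_iUnion₂.1 hxV
      exact ⟨D, hxD, hD⟩
    refine (encard_le_encard hsub).trans ((encard_image_le _ _).trans ?_)
    rw [← Subtype.val_injective.injOn.encard_image]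
    refine (encard_le_encard ?_).trans
      ((encard_le_order 𝒟 x).trans (order_le_of_familyDim_le h𝒟n))
    rintro _ ⟨D, hxD, rfl⟩
    exact ⟨D.2, hxD⟩

/-! ### Proper isometric actions -/

/-- If slices contain the members of a locally finite closed invariant covering of bounded order,
then the sets of points lying in precisely `m` members of the covering, cut into pieces by the
translates of the slices, are strata. -/
lemma exists_strata_of_isClosed_cover {G : Type*} [Group G] {F : Set (Subgroup G)}
    (hF : IsFamily F) {X ι : Type*} [Nonempty ι] [TopologicalSpace X] [MulAction G X]
    [ContinuousConstSMul G X] (hst : ∀ x : X, MulAction.stabilizer G x ∈ F) {n : ℕ} {p : ι → X}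
    {B : ι → Set X} (hB : ∀ i, IsSlice G (p i) (B i)) {K : ι → Set X} (hK : ∀ i, IsClosed (K i))
    (hKlf : LocallyFinite K) (hKc : ∀ x, ∃ i, x ∈ K i)
    (hKn : ∀ x, {i | x ∈ K i}.encard ≤ n + 1) (hKG : ∀ i (g : G) x, g • x ∈ K i ↔ x ∈ K i)
    (hKB : ∀ i, ∀ x ∈ K i, ∃ g : G, x ∈ g • B i) : ∃ (N : ℕ) (𝒞 : Fin N → Set (Set X)),
      (∀ i, IsFStratum F (𝒞 i)) ∧ ∀ x, ∃ i, ∃ c ∈ 𝒞 i, x ∈ c := by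
  classical
  have hch (s : Finset ι) : ∃ i, s.Nonempty → i ∈ s := by
    by_cases hs : s.Nonempty
    · exact ⟨hs.choose, fun _ => hs.choose_spec⟩
    · exact ⟨Classical.arbitrary ι, fun h => absurd h hs⟩
  choose i hi using hch
  let Z (s : Finset ι) : Set X := {x | ∀ j, x ∈ K j ↔ j ∈ s}
  have Z_inj {s s' : Finset ι} {x : X} (h : x ∈ Z s) (h' : x ∈ Z s') : s = s' := by
    ext j
    rw [← h j, ← h' j]
  have smul_Z (g : G) (s : Finset ι) : g • Z s = Z s := by
    ext x
    rw [mem_smul_set_iff_inv_smul_mem]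
    exact forall_congr' fun j => by rw [hKG]
  refine ⟨n + 2, fun m => {c | c.Nonempty ∧ ∃ (s : Finset ι) (g : G), s.card = m ∧
    c = Z s ∩ g • B (i s)}, fun m => ⟨?_, ?_, ?_, ?_⟩, fun x => ?_⟩
  · rintro _ ⟨-, s, g, -, rfl⟩ _ ⟨-, s', g', -, rfl⟩ hne
    refine disjoint_left.2 fun x hx hx' => hne ?_
    obtain rfl := Z_inj hx.1 hx'.1
    rcases (hB (i s)).eq_or_disjoint g g' with h | h
    · simp only [h]
    · exact absurd hx'.2 (disjoint_left.1 h hx.2)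
  · rintro g _ ⟨hne, s, k, hs, rfl⟩
    refine ⟨hne.smul_set, s, g * k, hs, ?_⟩
    rw [smul_set_inter, smul_Z, mul_smul]
  · rintro _ ⟨hne, s, g, -, rfl⟩
    exact hF.2 _ (hst (g • p (i s))) _ fun k hk =>
      (hB (i s)).smul_smul_eq hne inter_subset_right hk
  · rintro _ ⟨hne, s, g, hs, rfl⟩
    have hcl : IsClosed (⋃ j : {j // j ∉ s}, K j) :=
      (hKlf.comp_injective Subtype.val_injective).isClosed_iUnion fun j => hK j
    refine ⟨(⋃ j : {j // j ∉ s}, K j)ᶜ ∩ g • B (i s),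
      hcl.isOpen_compl.inter ((hB (i s)).isOpen.smul g), ?_⟩
    ext x
    constructor
    · rintro ⟨⟨hx, hxB⟩, _, ⟨-, s', g', hs', rfl⟩, hx', -⟩
      have hss : s' ⊆ s := fun j hj => by
        by_contra hjs
        exact hx (mem_iUnion.2 ⟨⟨j, hjs⟩, (hx' j).2 hj⟩)
      rw [Finset.eq_of_subset_of_card_le hss (by rw [hs, hs'])] at hx'
      exact ⟨hx', hxB⟩
    · intro hx
      refine ⟨⟨?_, hx.2⟩, _, ⟨hne, s, g, hs, rfl⟩, hx⟩
      rintro hx'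
      obtain ⟨j, hj⟩ := mem_iUnion.1 hx'
      exact j.2 ((hx.1 j).1 hj)
  · have hfin : {j | x ∈ K j}.Finite :=
      finite_of_encard_le_coe (k := n + 1) (by exact_mod_cast hKn x)
    have hx : x ∈ Z hfin.toFinset := fun j => by simp
    have hne : hfin.toFinset.Nonempty := by
      obtain ⟨j, hj⟩ := hKc x
      exact ⟨j, (hx j).1 hj⟩
    obtain ⟨g, hg⟩ := hKB _ x ((hx _).2 (hi _ hne))
    have hcard : hfin.toFinset.card < n + 2 := by
      have := hKn x
      rw [hfin.encard_eq_coe_toFinset_card] at this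
      have : hfin.toFinset.card ≤ n + 1 := by exact_mod_cast this
      omega
    exact ⟨⟨_, hcard⟩, Z hfin.toFinset ∩ g • B (i hfin.toFinset),
      ⟨⟨x, hx, hg⟩, _, g, rfl, rfl⟩, hx, hg⟩

/-- The orbit of a point is uniformly discrete. The factor `4` leaves room to conclude that distinct
translates of the ball of radius `r` have distance at least `2r`. -/
lemma IsProperAction.exists_radius {G X : Type*} [Group G] [MetricSpace X] [MulAction G X]
    (h : IsProperAction G X) (x : X) :
    ∃ r > 0, ∀ g : G, dist (g • x) x < 4 * r → g • x = x := by
  obtain ⟨W, hW, hfin⟩ := h x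
  obtain ⟨ε, hε, hεW⟩ := Metric.mem_nhds_iff.1 hW
  have hf : {g : G | dist (g • x) x < ε}.Finite := by
    refine hfin.subset fun g hg => ⟨g • x, smul_mem_smul_set (mem_of_mem_nhds hW), hεW hg⟩
  have hP : ∀ᶠ r : ℝ in nhdsWithin 0 (Ioi 0), ∀ g ∈ {g : G | dist (g • x) x < ε},
      dist (g • x) x < 4 * r → g • x = x := by
    refine (Filter.eventually_all_finite hf).2 fun g _ => ?_
    by_cases hg : g • x = x
    · exact Filter.Eventually.of_forall fun _ _ => hg
    · have : 0 < dist (g • x) x / 4 := by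
        have := dist_pos.2 hg
        linarith
      filter_upwards [nhdsWithin_le_nhds (eventually_lt_nhds this)] with r hr h
      linarith
  have hQ : ∀ᶠ r : ℝ in nhdsWithin 0 (Ioi 0), 4 * r < ε := by
    have : (0 : ℝ) < ε / 4 := by linarith
    filter_upwards [nhdsWithin_le_nhds (eventually_lt_nhds this)] with r hr
    linarith
  obtain ⟨r, ⟨hr1, hr2⟩, hr0⟩ := ((hP.and hQ).and self_mem_nhdsWithin).exists
  exact ⟨r, hr0, fun g hg => hr1 g (hg.trans hr2) hg⟩

section Isometric

variable {G X : Type*} [Group G] [MetricSpace X] [MulAction G X] [IsIsometricSMul G X]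

lemma isSlice_ball {x : X} {r : ℝ} (hr : 0 < r)
    (h : ∀ g : G, dist (g • x) x < 4 * r → g • x = x) : IsSlice G x (ball x r) := by
  refine ⟨isOpen_ball, mem_ball_self hr, fun g hg => by rw [Metric.smul_ball, hg],
    fun g hg => h g ?_⟩
  obtain ⟨y, hy, hy'⟩ := hg
  rw [Metric.smul_ball, mem_ball] at hy
  rw [mem_ball] at hy'
  have := dist_triangle_left (g • x) x y
  linarith

/-- The points of a closed ball that are fixed by the isotropy group of its centre. For small
radii this set is a closed set meeting every orbit at most once. -/
def fixedBall (G : Type*) {X : Type*} [Group G] [MetricSpace X] [MulAction G X] (x : X) (r : ℝ) :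
    Set X :=
  {y | dist y x ≤ r ∧ ∀ g : G, g • x = x → g • y = y}

lemma isClosed_fixedBall (x : X) (r : ℝ) : IsClosed (fixedBall G x r) := by
  have : fixedBall G x r = closedBall x r ∩ ⋂ g ∈ {g : G | g • x = x}, {y | g • y = y} := by
    ext y
    simp [fixedBall]
  rw [this]
  exact isClosed_closedBall.inter (isClosed_biInter fun g _ =>
    isClosed_eq (continuous_const_smul g) continuous_id)

lemma smul_eq_of_mem_fixedBall {x y : X} {r : ℝ} (hr : 0 < r)
    (h : ∀ g : G, dist (g • x) x < 4 * r → g • x = x) {g : G} (hy : y ∈ fixedBall G x r)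
    (hgy : g • y ∈ fixedBall G x r) : g • y = y := by
  refine hy.2 g (h g ?_)
  have h1 := dist_triangle_left (g • x) x (g • y)
  rw [dist_smul] at h1
  linarith [hy.1, hgy.1]

lemma isClosed_iUnion_smul_of_subset_fixedBall {x : X} {r : ℝ} (hr : 0 < r)
    (h : ∀ g : G, dist (g • x) x < 4 * r → g • x = x) {K : Set X} (hK : K ⊆ fixedBall G x r)
    (hKc : IsClosed K) : IsClosed (⋃ g : G, g • K) := by
  refine isClosed_of_closure_subset fun z hz => ?_
  have hz' : z ∈ closure (ball z (r / 2) ∩ ⋃ g : G, g • K) :=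
    isOpen_ball.inter_closure ⟨mem_ball_self (by linarith), hz⟩
  obtain ⟨w, hw, hwK⟩ := closure_nonempty_iff.1 ⟨z, hz'⟩
  obtain ⟨g, k, hk, rfl⟩ := mem_iUnion.1 hwK
  dsimp only at hw
  -- Distinct translates of `K` are too far apart for both to meet the small ball.
  have hsub : (ball z (r / 2) ∩ ⋃ g : G, g • K) ⊆ g • K := by
    rintro _ ⟨hw', hwK'⟩
    obtain ⟨g', k', hk', rfl⟩ := mem_iUnion.1 hwK'
    dsimp only at hw' ⊢
    have hgx : (g⁻¹ * g') • x = x := by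
      refine h _ ?_
      have e1 : dist ((g⁻¹ * g') • x) x = dist (g' • x) (g • x) := by
        rw [← dist_smul g, smul_smul, mul_inv_cancel_left]
      have e2 : dist (g' • k') (g' • x) ≤ r := by rw [dist_smul]; exact (hK hk').1
      have e3 : dist (g • k) (g • x) ≤ r := by rw [dist_smul]; exact (hK hk).1
      have e4 := dist_triangle_left (g' • x) (g • x) (g' • k')
      have e5 := dist_triangle (g' • k') (g • k) (g • x)
      have e6 := dist_triangle_right (g' • k') (g • k) z
      rw [mem_ball] at hw hw'
      linarith
    have hk'' := (hK hk').2 _ hgx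
    rw [mem_smul_set_iff_inv_smul_mem, smul_smul, hk'']
    exact hk'
  refine mem_iUnion.2 ⟨g, ?_⟩
  rw [← (hKc.smul g).closure_eq]
  exact closure_mono hsub hz'

/-- The isotropy groups of points close to `x` are contained in that of `x`. Therefore the points
near `x` whose isotropy group has the same cardinality have the same isotropy group. -/
lemma fixedBall_mem_nhdsWithin (hp : IsProperAction G X) {x : X} {r : ℝ} (hr : 0 < r)
    (h : ∀ g : G, dist (g • x) x < 4 * r → g • x = x) :
    fixedBall G x r ∈ nhdsWithin x
      {y | {g : G | g • y = y}.ncard = {g : G | g • x = x}.ncard} := by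
  refine mem_nhdsWithin.2 ⟨ball x r, isOpen_ball, mem_ball_self hr, fun y hy => ?_⟩
  obtain ⟨hy1, hy2⟩ := hy
  rw [mem_ball] at hy1
  have hsub : {g : G | g • y = y} ⊆ {g : G | g • x = x} := fun g hg => by
    refine h g ?_
    have h1 := dist_triangle_left (g • x) x (g • y)
    rw [dist_smul] at h1
    have h2 : g • y = y := hg
    rw [h2] at h1
    linarith
  have heq := eq_of_subset_of_ncard_le hsub (le_of_eq (Eq.symm hy2)) (hp.finite_stabilizer x)
  refine ⟨hy1.le, fun g hg => ?_⟩
  have : g ∈ {g : G | g • y = y} := by rw [heq]; exact hg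
  exact this

variable (G X) in
lemma regularSpace_quotient : RegularSpace (MulAction.orbitRel.Quotient G X) := by
  refine .of_exists_mem_nhds_isClosed_subset fun q s hs => ?_
  let π : X → MulAction.orbitRel.Quotient G X := Quotient.mk _
  have hπ : IsOpenQuotientMap π := MulAction.isOpenQuotientMap_quotientMk
  obtain ⟨x, rfl⟩ := hπ.surjective q
  have hs' : π ⁻¹' s ∈ nhds x := hπ.continuous.continuousAt hs
  obtain ⟨ε, hε, hεs⟩ := Metric.mem_nhds_iff.1 hs'
  have hsmul (g : G) (y : X) : π (g • y) = π y := Quotient.sound ⟨g, rfl⟩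
  have hne : (MulAction.orbit G x).Nonempty := ⟨x, MulAction.mem_orbit_self x⟩
  have hinv (g : G) (y : X) :
      infDist (g • y) (MulAction.orbit G x) = infDist y (MulAction.orbit G x) := by
    conv_lhs => rw [← MulAction.smul_orbit g x]
    rw [infDist, infDist, infEDist_smul]
  refine ⟨π '' {y | infDist y (MulAction.orbit G x) ≤ ε / 2}, ?_, ?_, ?_⟩
  · refine Filter.mem_of_superset (hπ.isOpenMap.image_mem_nhds (ball_mem_nhds x (half_pos hε))) ?_
    refine image_mono fun y hy => ?_
    exact (infDist_le_dist_of_mem (MulAction.mem_orbit_self x)).trans (le_of_lt hy)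
  · rw [← hπ.isQuotientMap.isClosed_preimage]
    have : π ⁻¹' (π '' {y | infDist y (MulAction.orbit G x) ≤ ε / 2}) =
        {y | infDist y (MulAction.orbit G x) ≤ ε / 2} := by
      refine subset_antisymm ?_ (subset_preimage_image _ _)
      rintro y ⟨z, hz, hzy⟩
      obtain ⟨g, rfl⟩ : ∃ g : G, g • y = z := Quotient.exact hzy
      rwa [mem_ofPred_eq, hinv] at hz
    rw [this]
    exact isClosed_le (continuous_infDist_pt _) continuous_const
  · rintro _ ⟨y, hy, rfl⟩
    have hlt : infDist y (MulAction.orbit G x) < ε := lt_of_le_of_lt hy (by linarith)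
    obtain ⟨_, ⟨g, rfl⟩, hg⟩ := (infDist_lt_iff hne).1 hlt
    dsimp only at hg
    have : g⁻¹ • y ∈ ball x ε := by
      rw [mem_ball, ← dist_smul g, smul_inv_smul]
      exact hg
    have := hεs this
    rwa [mem_preimage, hsmul] at this

/-- The fixed point sets in small balls embed in the orbit space as closed subsets, and countably
many of them cover it; so locally finite coverings of the orbit space can be shrunk to bounded
order. -/
lemma IsProperAction.exists_strata_of_coveringDimLE [SecondCountableTopology X]
    {F : Set (Subgroup G)} (hF : IsFamily F) (hp : IsProperAction G X)
    (hst : ∀ x : X, MulAction.stabilizer G x ∈ F) {n : ℕ} (hn : CoveringDimLE X n) :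
    ∃ (N : ℕ) (𝒞 : Fin N → Set (Set X)),
      (∀ i, IsFStratum F (𝒞 i)) ∧ ∀ x, ∃ i, ∃ c ∈ 𝒞 i, x ∈ c := by
  rcases isEmpty_or_nonempty X with hX | hX
  · exact ⟨0, Fin.elim0, fun i => i.elim0, fun x => isEmptyElim x⟩
  choose r hr hrG using hp.exists_radius
  let Y := MulAction.orbitRel.Quotient G X
  let π : X → Y := Quotient.mk _
  have hπ : IsOpenQuotientMap π := MulAction.isOpenQuotientMap_quotientMk
  have hsmul (g : G) (y : X) : π (g • y) = π y := Quotient.sound ⟨g, rfl⟩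
  have : RegularSpace Y := regularSpace_quotient G X
  have : SecondCountableTopology Y := ContinuousConstSMul.secondCountableTopology
  let _ : PseudoMetricSpace Y := TopologicalSpace.pseudoMetrizableSpacePseudoMetric Y
  -- Countably many of the sets `fixedBall G x (r x)` cover `X`.
  have hlind (k : ℕ) : ∃ T : Set X, T.Countable ∧
      ∀ y : X, {g : G | g • y = y}.ncard = k → ∃ x ∈ T, y ∈ fixedBall G x (r x) := by
    obtain ⟨T, -, hT, hTc⟩ := TopologicalSpace.countable_cover_nhdsWithin
      (f := fun x => fixedBall G x (r x)) (s := {y : X | {g : G | g • y = y}.ncard = k})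
      fun x hx => by
        have hx : {g : G | g • x = x}.ncard = k := hx
        have := fixedBall_mem_nhdsWithin hp (hr x) (hrG x)
        rwa [hx] at this
    refine ⟨T, hT, fun y hy => ?_⟩
    obtain ⟨x, hx, hyx⟩ := mem_iUnion₂.1 (hTc hy)
    exact ⟨x, hx, hyx⟩
  choose T hT hTc using hlind
  have hne : (⋃ k, T k).Nonempty := by
    obtain ⟨y⟩ := hX
    obtain ⟨x, hx, -⟩ := hTc _ y rfl
    exact ⟨x, mem_iUnion.2 ⟨_, hx⟩⟩
  obtain ⟨f, hf⟩ := (countable_iUnion hT).exists_eq_range hne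
  let E (j : ℕ) : Set X := fixedBall G (f j) (r (f j))
  have hE (y : Y) : ∃ j, y ∈ π '' E j := by
    obtain ⟨y, rfl⟩ := hπ.surjective y
    obtain ⟨x, hx, hxy⟩ := hTc _ y rfl
    have hx' : x ∈ range f := hf ▸ mem_iUnion.2 ⟨_, hx⟩
    obtain ⟨j, rfl⟩ := hx'
    exact ⟨j, y, hxy, rfl⟩
  have hEinj (j : ℕ) : InjOn π (E j) := by
    intro y hy z hz hyz
    obtain ⟨g, rfl⟩ : ∃ g : G, g • z = y := Quotient.exact hyz
    exact smul_eq_of_mem_fixedBall (hr _) (hrG _) hz hy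
  have hEclosed (j : ℕ) (K : Set X) (hK : K ⊆ E j) (hKc : IsClosed K) : IsClosed (π '' K) := by
    rw [← hπ.isQuotientMap.isClosed_preimage]
    have : π ⁻¹' (π '' K) = ⋃ g : G, g • K := by
      ext y
      rw [mem_iUnion]
      constructor
      · rintro ⟨z, hz, hzy⟩
        obtain ⟨g, rfl⟩ : ∃ g : G, g • y = z := Quotient.exact hzy
        exact ⟨g⁻¹, mem_smul_set_iff_inv_smul_mem.2 (by rwa [inv_inv])⟩
      · rintro ⟨g, z, hz, rfl⟩
        exact ⟨z, hz, (hsmul g z).symm⟩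
    rw [this]
    exact isClosed_iUnion_smul_of_subset_fixedBall (hr _) (hrG _) hK hKc
  obtain ⟨U, hU, hUc, hUlf, hUB⟩ := precise_refinement (fun x => π '' ball x (r x))
    (fun x => hπ.isOpenMap _ isOpen_ball) (eq_univ_of_forall fun y => by
      obtain ⟨x, rfl⟩ := hπ.surjective y
      exact mem_iUnion.2 ⟨x, x, mem_ball_self (hr x), rfl⟩)
  obtain ⟨K, hK, hKc, hKU, hKn⟩ := exists_isClosed_shrinking (n := n) (fun j => π '' E j) hE
    (fun j U hU hUc => hn.exists_shrinking hπ.continuous (isClosed_fixedBall _ _) (hEinj j)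
      (hEclosed j) U hU hUc) U hU hUc hUlf.point_finite
  refine exists_strata_of_isClosed_cover hF hst (n := n) (p := fun x : X => x)
    (fun x => isSlice_ball (hr x) (hrG x)) (K := fun x => π ⁻¹' K x)
    (fun x => (hK x).preimage hπ.continuous)
    ((hUlf.subset hKU).preimage_continuous hπ.continuous) (fun x => ?_) (fun x => hKn (π x))
    (fun i g x => by rw [mem_preimage, hsmul, mem_preimage]) fun i x hx => ?_
  · have : π x ∈ ⋃ i, K i := by rw [hKc]; trivial
    obtain ⟨i, hi⟩ := mem_iUnion.1 this
    exact ⟨i, hi⟩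
  · obtain ⟨z, hz, hzx⟩ := hUB i (hKU i hx)
    obtain ⟨g, rfl⟩ : ∃ g : G, g • x = z := Quotient.exact hzx
    exact ⟨g⁻¹, mem_smul_set_iff_inv_smul_mem.2 (by rwa [inv_inv])⟩

end Isometric

lemma ProperCondition.exists_strata {G : Type*} [Group G] {F : Set (Subgroup G)}
    (hF : IsFamily F) {X : Type*} [t : TopologicalSpace X] [T2Space X]
    [SecondCountableTopology X] [MulAction G X] [ContinuousConstSMul G X]
    (h : ProperCondition F X) : ∃ (N : ℕ) (𝒞 : Fin N → Set (Set X)),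
      (∀ i, IsFStratum F (𝒞 i)) ∧ ∀ x, ∃ i, ∃ c ∈ 𝒞 i, x ∈ c := by
  obtain ⟨-, hp, hst, _ | ⟨⟨n, hn⟩, m, rfl, hm⟩⟩ := h
  · exact hp.exists_strata_of_compactSpace hF hst
  · have : IsIsometricSMul G X := ⟨fun g => Isometry.of_dist_eq (hm g)⟩
    exact hp.exists_strata_of_coveringDimLE hF hst hn

end EqAsdim

theorem mainTheorem2
    {G : Type*} [Group G] [TopologicalSpace G] [DiscreteTopology G]
    (S : Finset G) (hS : Subgroup.closure (S : Set G) = ⊤)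
    (F : Set (Subgroup G)) (hF : EqAsdim.IsFamily F)
    {Xbar : Type*} [TopologicalSpace Xbar] [CompactSpace Xbar] [TopologicalSpace.MetrizableSpace Xbar]
    [MulAction G Xbar] [ContinuousConstSMul G Xbar]
    (X : SubMulAction G Xbar) (hX : Dense (X : Set Xbar))
    (hyp : EqAsdim.SimplicialCondition F X ∨ EqAsdim.CWCondition F X ∨
      EqAsdim.ProperCondition F X) :
    (∃ 𝒰inf : Set (Set (G × X)),
      EqAsdim.IsEqasdimCover (S : Set G) F ⊤ 𝒰inf ∧ EqAsdim.familyDim 𝒰inf < ⊤) ∧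
    ∀ 𝒰inf : Set (Set (G × X)), EqAsdim.IsEqasdimCover (S : Set G) F ⊤ 𝒰inf →
    ∀ (α : ENNReal) (𝒱 : Set (Set (G × EqAsdim.boundary X))),
      EqAsdim.IsEqasdimCover (S : Set G) F α 𝒱 →
      ∃ 𝒰 : Set (Set (G × Xbar)),
        EqAsdim.IsEqasdimCover (S : Set G) F α 𝒰 ∧
        EqAsdim.familyDim 𝒰 ≤ EqAsdim.familyDim 𝒱 + EqAsdim.familyDim 𝒰inf + 1 ∧
        ∃ 𝒲 ⊆ 𝒰, EqAsdim.IsInvariantFamily G 𝒲 ∧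
          Set.BijOn (EqAsdim.trace (EqAsdim.boundary X)) 𝒲 𝒱 ∧
          EqAsdim.familyDim 𝒲 = EqAsdim.familyDim 𝒱 := by
  let _ : MetricSpace Xbar := TopologicalSpace.metrizableSpaceMetric Xbar
  refine ⟨?_, fun 𝒰inf h𝒰 α 𝒱 h𝒱 => ?_⟩
  · have : ContinuousConstSMul G X := ⟨fun g =>
      ((continuous_const_smul g).comp continuous_subtype_val).subtype_mk _⟩
    have : SecondCountableTopology Xbar := inferInstance
    obtain ⟨N, 𝒞, h𝒞, hcov⟩ : ∃ (N : ℕ) (𝒞 : Fin N → Set (Set X)),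
        (∀ i, EqAsdim.IsFStratum F (𝒞 i)) ∧ ∀ x, ∃ i, ∃ c ∈ 𝒞 i, x ∈ c := by
      rcases hyp with h | h | h
      exacts [h.exists_strata hF, h.exists_strata, h.exists_strata hF]
    exact EqAsdim.exists_isEqasdimCover_top_of_strata (S : Set G) 𝒞 h𝒞 hcov
  · refine ⟨_, .extend_union (EqAsdim.boundary X) X (fun z => (em (z ∈ X)).symm) h𝒱
      (h𝒰.of_top α), EqAsdim.familyDim_le_add ?_, _, Set.subset_union_left,
      h𝒱.isFCover.invariant.image_extend _, EqAsdim.bijOn_trace_extend _ h𝒱.isOpen,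
      EqAsdim.familyDim_congr (EqAsdim.order_image_extend _ h𝒱.isOpen)⟩
    refine (EqAsdim.order_union_le _ _).trans (le_of_eq ?_)
    rw [EqAsdim.order_image_extend _ h𝒱.isOpen, EqAsdim.order_image_extend _ h𝒰.isOpen]
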